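/- Let $\mathbb U$ be the open unit disc, $\hat{\mathbb C}=\mathbb C\cup\{\infty\}$, and $\rho(z)=1/\bar z$ the inversion of $\hat{\mathbb C}$ in the unit circle ($\rho(0)=\infty$, $\rho(\infty)=0$). Let $H^2$ be the Hilbert space of holomorphic functions $f(z)=\sum_{n\ge 0}\hat f(n)z^n$ on $\mathbb U$ with $\sum_n|\hat f(n)|^2<\infty$ and inner product $\langle f,g\rangle=\sum_n\hat f(n)\overline{\hat g(n)}$. Let $\varphi$ be a rational function of degree $d>0$ (the degree being the larger of the degrees of numerator and denominator in lowest terms) with $\varphi(\mathbb U)\subset\mathbb U$, and let $\varphi_e=\rho\circ\varphi\circ\rho$, which is again a rational function. A point of $\hat{\mathbb C}$ is a regular value of a rational function $R$ of degree $m$ if its preimage under $R$ in $\hat{\mathbb C}$ has $m$ distinct points. The composition operator $C_\varphi f=f\circ\varphi$ is a bounded operator on $H^2$. Let $f\in H^2$ and let $z\in\mathbb U$ be a regular value of $\varphi_e$. Then $\varphi_e^{-1}(\{z\})\subset\mathbb U$, $\varphi_e'(w)\ne 0$ for every $w\in\varphi_e^{-1}(\{z\})$, and $0\notin\varphi_e^{-1}(\{z\})$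 if $z\neq \rho(\varphi(\infty))$. Moreover: (a) If $\varphi(\infty)\ne\infty$ and $z\ne 1/\overline{\varphi(\infty)}$ (where $1/\overline{0}=\infty$), then $$C_\varphi^*f(z)=\frac{f(0)}{1-\overline{\varphi(\infty)}\,z}+z\sum_{w\in\varphi_e^{-1}(\{z\})}\frac{f(w)}{w\,\varphi_e'(w)}.$$ (b) If $\varphi(\infty)=\infty$, then $$C_\varphi^*f(z)=z\sum_{w\in\varphi_e^{-1}(\{z\})}\frac{f(w)}{w\,\varphi_e'(w)}\quad\text{if } z\ne 0,\qquad C_\varphi^*f(0)=f(0)\quad\text{if } z=0.$$ -/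

import Mathlib

open scoped ComplexConjugate Complex.UnitDisc OnePoint
open Polynomial

noncomputable section

namespace HardyComposition

section RationalMaps

/-- The degree of a rational function, written in lowest terms: the larger of the degrees of its
numerator and its denominator. -/
def ratDegree (R : RatFunc ℂ) : ℕ := max R.num.natDegree R.denom.natDegree

/-- A rational function, as a function with finite values away from its poles
(at a pole the value is a dummy `0`). -/
def finiteMap (R : RatFunc ℂ) (w : ℂ) : ℂ := R.num.eval w / R.denom.eval w

open Classical in
/-- The selfmap of the Riemann sphere `ℂ ∪ {∞}` given by a rational function. The denominator is
monic, so the value at `∞`, when finite, is the coefficient of the numerator in the degree of the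
denominator. -/
def sphereMap (R : RatFunc ℂ) : OnePoint ℂ → OnePoint ℂ
  | ∞ => if R.denom.natDegree < R.num.natDegree then ∞
      else ((R.num.coeff R.denom.natDegree : ℂ) : OnePoint ℂ)
  | (w : ℂ) => if R.denom.eval w = 0 then ∞ else ((finiteMap R w : ℂ) : OnePoint ℂ)

open Classical in
/-- Inversion in the unit circle, `z ↦ 1 / conj z`, on the Riemann sphere. -/
def inversion : OnePoint ℂ → OnePoint ℂ
  | ∞ => ((0 : ℂ) : OnePoint ℂ)
  | (w : ℂ) => if w = 0 then ∞ else ((1 / conj w : ℂ) : OnePoint ℂ)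

/-- The rational function maps the open unit disc into itself. -/
def MapsDisc (R : RatFunc ℂ) : Prop :=
  ∀ z : 𝔻, ∃ v : 𝔻, sphereMap R ((z : ℂ) : OnePoint ℂ) = ((v : ℂ) : OnePoint ℂ)

/-- A point of the sphere is a regular value of `R` if its preimage has as many distinct points as
the degree of `R`. -/
def IsRegularValue (R : RatFunc ℂ) (x : OnePoint ℂ) : Prop :=
  (sphereMap R ⁻¹' {x}).encard = ratDegree R

/-- The numerator of the exterior map: `w ^ d * conj (q (1 / conj w))`, where `φ = p / q` in lowest
terms and `d` is the degree of `φ`. -/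
def exteriorNum (φ : RatFunc ℂ) : ℂ[X] :=
  (φ.denom.map (starRingEnd ℂ)).reflect (ratDegree φ)

/-- The denominator of the exterior map: `w ^ d * conj (p (1 / conj w))`. -/
def exteriorDenom (φ : RatFunc ℂ) : ℂ[X] :=
  (φ.num.map (starRingEnd ℂ)).reflect (ratDegree φ)

/-- The exterior map of a nonzero rational function `φ`, as a rational function. As a selfmap of
the sphere it is `inversion ∘ φ ∘ inversion`: see `sphereMap_exterior`. -/
def exterior (φ : RatFunc ℂ) : RatFunc ℂ :=
  algebraMap ℂ[X] (RatFunc ℂ) (exteriorNum φ) / algebraMap ℂ[X] (RatFunc ℂ) (exteriorDenom φ)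

end RationalMaps
theorem exists_num_denom_eq {P Q : ℂ[X]} (hQ : Q ≠ 0) (h : IsCoprime P Q) :
    ∃ c : ℂ, c ≠ 0 ∧
      P = C c * (algebraMap ℂ[X] (RatFunc ℂ) P / algebraMap ℂ[X] (RatFunc ℂ) Q).num ∧
      Q = C c * (algebraMap ℂ[X] (RatFunc ℂ) P / algebraMap ℂ[X] (RatFunc ℂ) Q).denom := by
  set R := algebraMap ℂ[X] (RatFunc ℂ) P / algebraMap ℂ[X] (RatFunc ℂ) Q with hR
  have h1 : R.num * Q = P * R.denom := (RatFunc.num_mul_eq_mul_denom_iff hQ).2 hR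
  have h2 : Q ∣ R.denom := h.symm.dvd_of_dvd_mul_left ⟨R.num, by rw [← h1]; ring⟩
  have h3 : R.denom ∣ Q := RatFunc.denom_div_dvd P Q
  obtain ⟨u, hu⟩ := associated_of_dvd_dvd h3 h2
  obtain ⟨c, hc, hcu⟩ := Polynomial.isUnit_iff.1 u.isUnit
  refine ⟨c, hc.ne_zero, ?_, by rw [hcu, mul_comm, hu]⟩
  apply mul_right_cancel₀ (RatFunc.denom_ne_zero R)
  rw [← h1, ← hu, hcu]; ring

/-- The sphere map of a quotient of coprime polynomials, at a finite point. -/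
theorem sphereMap_div_coe {P Q : ℂ[X]} (hQ : Q ≠ 0) (h : IsCoprime P Q) (w : ℂ) :
    sphereMap (algebraMap ℂ[X] (RatFunc ℂ) P / algebraMap ℂ[X] (RatFunc ℂ) Q) (w : OnePoint ℂ) =
      if Q.eval w = 0 then ∞ else ((P.eval w / Q.eval w : ℂ) : OnePoint ℂ) := by
  obtain ⟨c, hc, hP, hQ'⟩ := exists_num_denom_eq hQ h
  set R := algebraMap ℂ[X] (RatFunc ℂ) P / algebraMap ℂ[X] (RatFunc ℂ) Q
  have e1 : Q.eval w = c * R.denom.eval w := by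
    conv_lhs => rw [hQ']
    simp
  have e2 : P.eval w = c * R.num.eval w := by
    conv_lhs => rw [hP]
    simp
  simp only [sphereMap, finiteMap, e1, e2, mul_eq_zero, hc, false_or, mul_div_mul_left _ _ hc]

/-- The sphere map of a quotient of coprime polynomials of degree at most `d`, one of them of
degree `d`, at infinity. -/
theorem sphereMap_div_infty {P Q : ℂ[X]} (hQ : Q ≠ 0) (h : IsCoprime P Q) {d : ℕ}
    (hPd : P.natDegree ≤ d) (hQd : Q.natDegree ≤ d) (hd : P.coeff d ≠ 0 ∨ Q.coeff d ≠ 0) :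
    sphereMap (algebraMap ℂ[X] (RatFunc ℂ) P / algebraMap ℂ[X] (RatFunc ℂ) Q) ∞ =
      if Q.coeff d = 0 then ∞ else ((P.coeff d / Q.coeff d : ℂ) : OnePoint ℂ) := by
  obtain ⟨c, hc, hP, hQ'⟩ := exists_num_denom_eq hQ h
  set R := algebraMap ℂ[X] (RatFunc ℂ) P / algebraMap ℂ[X] (RatFunc ℂ) Q
  have hm : R.denom.Monic := RatFunc.monic_denom R
  have e1 : ∀ n, Q.coeff n = c * R.denom.coeff n := fun n => by
    conv_lhs => rw [hQ']
    simp
  have e2 : ∀ n, P.coeff n = c * R.num.coeff n := fun n => by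
    conv_lhs => rw [hP]
    simp
  have n1 : Q.natDegree = R.denom.natDegree := by
    conv_lhs => rw [hQ']
    rw [natDegree_C_mul hc]
  have n2 : P.natDegree = R.num.natDegree := by
    conv_lhs => rw [hP]
    rw [natDegree_C_mul hc]
  simp only [sphereMap, e1, e2, mul_eq_zero, hc, false_or, mul_div_mul_left _ _ hc]
  by_cases hq : R.denom.coeff d = 0
  · have h1 : R.denom.natDegree ≠ d := fun h0 => by
      rw [← h0, hm.coeff_natDegree] at hq
      exact one_ne_zero hq
    have h2 : d ≤ R.num.natDegree := by
      rw [← n2]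
      apply le_natDegree_of_ne_zero
      rcases hd with hd | hd
      · exact hd
      · exact absurd (by rw [e1, hq, mul_zero]) hd
    have h3 : R.denom.natDegree < R.num.natDegree := by omega
    simp [hq, h3]
  · have h1 : R.denom.natDegree = d :=
      le_antisymm (n1 ▸ hQd) (le_natDegree_of_ne_zero hq)
    have h3 : ¬ R.denom.natDegree < R.num.natDegree := by omega
    have h4 : R.denom.coeff d = 1 := by rw [← h1]; exact hm.coeff_natDegree
    rw [if_neg h3, if_neg hq, h4, h1, div_one]

theorem eval_reflect_map {d : ℕ} {P : ℂ[X]} (hP : P.natDegree ≤ d) {w : ℂ} (hw : w ≠ 0) :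
    ((P.map (starRingEnd ℂ)).reflect d).eval w = w ^ d * conj (P.eval (1 / conj w)) := by
  have hw' : w⁻¹ ≠ 0 := inv_ne_zero hw
  let _ : Invertible w⁻¹ := invertibleOfNonzero hw'
  have h := eval₂_reflect_mul_pow (RingHom.id ℂ) w⁻¹ d (P.map (starRingEnd ℂ))
    (by rwa [natDegree_map])
  rw [invOf_eq_inv, inv_inv] at h
  simp only [eval₂_id] at h
  have h2 : (P.map (starRingEnd ℂ)).eval w⁻¹ = conj (P.eval (1 / conj w)) := by
    have := Polynomial.eval_map_apply (starRingEnd ℂ) (p := P) (1 / conj w)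
    rw [← this]; simp
  rw [← h2, ← h, inv_pow, mul_left_comm, mul_inv_cancel₀ (pow_ne_zero d hw), mul_one]

theorem coeff_ratDegree (φ : RatFunc ℂ) (h0 : φ ≠ 0) :
    φ.num.coeff (ratDegree φ) ≠ 0 ∨ φ.denom.coeff (ratDegree φ) ≠ 0 := by
  rcases max_choice φ.num.natDegree φ.denom.natDegree with h | h
  · left; rw [ratDegree, h]; simpa using h0
  · right; rw [ratDegree, h]; simp [RatFunc.denom_ne_zero]

theorem coeff_zero_exterior (φ : RatFunc ℂ) :
    (exteriorNum φ).eval 0 = conj (φ.denom.coeff (ratDegree φ)) ∧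
    (exteriorDenom φ).eval 0 = conj (φ.num.coeff (ratDegree φ)) := by
  simp [exteriorNum, exteriorDenom, ← coeff_zero_eq_eval_zero, coeff_reflect]

theorem isCoprime_exterior (φ : RatFunc ℂ) (h0 : φ ≠ 0) :
    IsCoprime (exteriorNum φ) (exteriorDenom φ) := by
  have hdd : φ.denom.natDegree ≤ ratDegree φ := le_max_right _ _
  have hdn : φ.num.natDegree ≤ ratDegree φ := le_max_left _ _
  rw [isCoprime_iff_aeval_ne_zero_of_isAlgClosed ℂ ℂ]
  intro w
  simp only [coe_aeval_eq_eval]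
  rcases eq_or_ne w 0 with rfl | hw
  · rw [(coeff_zero_exterior φ).1, (coeff_zero_exterior φ).2]
    simpa using (coeff_ratDegree φ h0).symm
  · rw [exteriorNum, exteriorDenom, eval_reflect_map hdd hw,
      eval_reflect_map hdn hw]
    have := (isCoprime_iff_aeval_ne_zero_of_isAlgClosed ℂ ℂ _ _).1
      φ.isCoprime_num_denom (1 / conj w)
    simp only [coe_aeval_eq_eval] at this
    simpa [hw] using this.symm

/-- On the sphere, the exterior map of `φ` is `inversion ∘ φ ∘ inversion`. -/
theorem sphereMap_exterior (φ : RatFunc ℂ) (h0 : φ ≠ 0) (x : OnePoint ℂ) :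
    sphereMap (exterior φ) x = inversion (sphereMap φ (inversion x)) := by
  have hdd : φ.denom.natDegree ≤ ratDegree φ := le_max_right _ _
  have hdn : φ.num.natDegree ≤ ratDegree φ := le_max_left _ _
  have hcop := isCoprime_exterior φ h0
  have hQ : exteriorDenom φ ≠ 0 := by
    rw [exteriorDenom, Ne, reflect_eq_zero_iff, Polynomial.map_eq_zero]
    simpa using h0
  have hm : φ.denom.Monic := RatFunc.monic_denom φ
  have hN : (exteriorNum φ).natDegree ≤ ratDegree φ := by
    refine natDegree_reflect_le.trans ?_
    rw [natDegree_map]; simp [ratDegree]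
  have hD : (exteriorDenom φ).natDegree ≤ ratDegree φ := by
    refine natDegree_reflect_le.trans ?_
    rw [natDegree_map]; simp [ratDegree]
  have cN : (exteriorNum φ).coeff (ratDegree φ) = conj (φ.denom.eval 0) := by
    simp [exteriorNum, coeff_reflect, ← coeff_zero_eq_eval_zero]
  have cD : (exteriorDenom φ).coeff (ratDegree φ) = conj (φ.num.eval 0) := by
    simp [exteriorDenom, coeff_reflect, ← coeff_zero_eq_eval_zero]
  have hc0 : ∀ w : ℂ, φ.num.eval w ≠ 0 ∨ φ.denom.eval w ≠ 0 := fun w => by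
    have := (isCoprime_iff_aeval_ne_zero_of_isAlgClosed ℂ ℂ _ _).1
      φ.isCoprime_num_denom w
    simpa only [coe_aeval_eq_eval] using this
  induction x using OnePoint.rec with
  | infty =>
    rw [exterior, sphereMap_div_infty hQ hcop hN hD (by
      rw [cN, cD]; simpa using (hc0 0).symm), cN, cD]
    by_cases hd : φ.denom.eval 0 = 0
    · have hn : φ.num.eval 0 ≠ 0 := (hc0 0).resolve_right (by simp [hd])
      simp [inversion, sphereMap, hd, hn]
    · by_cases hn : φ.num.eval 0 = 0 <;> simp [inversion, sphereMap, finiteMap, hd, hn]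
  | coe w =>
    rw [exterior, sphereMap_div_coe hQ hcop]
    rcases eq_or_ne w 0 with rfl | hw
    · rw [(coeff_zero_exterior φ).1, (coeff_zero_exterior φ).2]
      by_cases hlt : φ.denom.natDegree < φ.num.natDegree
      · have e : ratDegree φ = φ.num.natDegree := max_eq_left hlt.le
        have e1 : φ.denom.coeff φ.num.natDegree = 0 := coeff_eq_zero_of_natDegree_lt hlt
        simp [inversion, sphereMap, hlt, e, e1, h0]
      · have e : ratDegree φ = φ.denom.natDegree := max_eq_right (not_lt.1 hlt)
        by_cases hn : φ.num.coeff φ.denom.natDegree = 0 <;>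
          simp [inversion, sphereMap, hlt, e, hm.leadingCoeff, hn]
    · rw [exteriorNum, exteriorDenom, eval_reflect_map hdd hw,
        eval_reflect_map hdn hw]
      by_cases hd : φ.denom.eval (1 / conj w) = 0
      · have hn : φ.num.eval (1 / conj w) ≠ 0 := (hc0 _).resolve_right (not_not.2 hd)
        simp only [one_div] at hd hn
        simp [inversion, sphereMap, hd, hn, hw]
      · simp only [one_div] at hd
        by_cases hn : φ.num.eval (conj w)⁻¹ = 0 <;>
          simp [inversion, sphereMap, finiteMap, hd, hn, hw, mul_div_mul_left]

section HardySpace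

open Classical in
/-- A function on the disc, extended by the dummy value `0` outside it. -/
def extendZero (f : 𝔻 → ℂ) (w : ℂ) : ℂ := if h : ‖w‖ < 1 then f (Complex.UnitDisc.mk w h) else 0

/-- Holomorphy of a function on the open unit disc. -/
def IsHolomorphic (f : 𝔻 → ℂ) : Prop := DifferentiableOn ℂ (extendZero f) (Metric.ball 0 1)

/-- The `n`-th Maclaurin coefficient of a function on the disc. -/
def maclaurin (f : 𝔻 → ℂ) (n : ℕ) : ℂ := iteratedDeriv n (extendZero f) 0 / (n.factorial : ℂ)

theorem extendZero_coe (f : 𝔻 → ℂ) (z : 𝔻) : extendZero f z = f z := by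
  simp [extendZero, z.norm_lt_one]

/-- A holomorphic function is the sum of its Maclaurin series. -/
theorem hasSum_maclaurin {f : 𝔻 → ℂ} (hf : IsHolomorphic f) (z : 𝔻) :
    HasSum (fun n => maclaurin f n * (z : ℂ) ^ n) (f z) := by
  have h := Complex.hasSum_taylorSeries_on_ball (r := 1) hf (z := (z : ℂ))
    (by simpa using z.norm_lt_one)
  rw [extendZero_coe] at h
  have e : (fun n => maclaurin f n * (z : ℂ) ^ n) = fun n : ℕ =>
      (n.factorial : ℂ)⁻¹ • ((z : ℂ) - 0) ^ n • iteratedDeriv n (extendZero f) 0 := by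
    funext n
    simp only [maclaurin, smul_eq_mul, sub_zero]
    ring
  rw [e]
  exact h

/-- The sum of a power series on the disc is holomorphic, with the expected coefficients. -/
theorem of_hasSum {f : 𝔻 → ℂ} {a : ℕ → ℂ}
    (h : ∀ z : 𝔻, HasSum (fun n => a n * (z : ℂ) ^ n) (f z)) :
    IsHolomorphic f ∧ maclaurin f = a := by
  have hr : (1 : ENNReal) ≤ (FormalMultilinearSeries.ofScalars ℂ a).radius := by
    refine ENNReal.le_of_forall_nnreal_lt fun r hr => ?_
    have hr1 : r < 1 := by exact_mod_cast hr
    apply FormalMultilinearSeries.le_radius_of_summable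
    have hz := (h (Complex.UnitDisc.mk (r : ℂ) (by simpa using hr1))).summable.norm
    simpa [FormalMultilinearSeries.ofScalars_norm] using hz
  have hp : HasFPowerSeriesOnBall (extendZero f) (FormalMultilinearSeries.ofScalars ℂ a) 0 1 := by
    refine ⟨hr, one_pos, fun {y} hy => ?_⟩
    have hy1 : ‖y‖ < 1 := by
      rwa [Metric.mem_eball, edist_zero_right, ← ofReal_norm, ENNReal.ofReal_lt_one] at hy
    have := h (Complex.UnitDisc.mk y hy1)
    simpa [extendZero, hy1, FormalMultilinearSeries.ofScalars_apply_eq, mul_comm] using this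
  refine ⟨?_, ?_⟩
  · have := hp.differentiableOn
    rwa [← ENNReal.ofReal_one, Metric.eball_ofReal] at this
  · funext n
    have h1 := hp.hasFPowerSeriesAt.eq_formalMultilinearSeries
      (hp.hasFPowerSeriesAt.analyticAt.hasFPowerSeriesAt)
    have := congrArg (fun p => FormalMultilinearSeries.coeff p n) h1
    simpa [maclaurin, FormalMultilinearSeries.coeff_ofScalars] using this.symm

/-- The Hardy space `H²` as a space of functions on the open unit disc: the holomorphic functions
with square-summable Maclaurin coefficients. -/
def hardySubmodule : Submodule ℂ (𝔻 → ℂ) where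
  carrier := {f | IsHolomorphic f ∧ Summable fun n => ‖maclaurin f n‖ ^ 2}
  zero_mem' := by
    have h := of_hasSum (f := 0) (a := 0) (fun z => by simp)
    exact ⟨h.1, by simp [h.2]⟩
  add_mem' := by
    rintro f g ⟨hf, hf2⟩ ⟨hg, hg2⟩
    have h := of_hasSum (f := f + g) (a := maclaurin f + maclaurin g) fun z => by
      simpa [add_mul] using (hasSum_maclaurin hf z).add (hasSum_maclaurin hg z)
    refine ⟨h.1, ?_⟩
    rw [h.2]
    refine Summable.of_nonneg_of_le (fun n => by positivity) (fun n => ?_)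
      ((hf2.add hg2).mul_left 2)
    have := norm_add_le (maclaurin f n) (maclaurin g n)
    have h0 := norm_nonneg (maclaurin f n + maclaurin g n)
    simp only [Pi.add_apply]
    nlinarith [sq_nonneg (‖maclaurin f n‖ - ‖maclaurin g n‖)]
  smul_mem' := by
    rintro c f ⟨hf, hf2⟩
    have h := of_hasSum (f := c • f) (a := c • maclaurin f) fun z => by
      simpa [mul_assoc] using (hasSum_maclaurin hf z).mul_left c
    refine ⟨h.1, ?_⟩
    rw [h.2]
    simpa [mul_pow] using hf2.mul_left (‖c‖ ^ 2)

/-- The Hardy space `H²` of the open unit disc, with the norm and inner product defined below. -/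
def HardySpace : Type := hardySubmodule

namespace HardySpace

instance : AddCommGroup HardySpace := inferInstanceAs (AddCommGroup hardySubmodule)

instance : Module ℂ HardySpace := inferInstanceAs (Module ℂ hardySubmodule)

instance : CoeFun HardySpace fun _ => 𝔻 → ℂ := ⟨fun f => f.1⟩

/-- The Maclaurin coefficients of a function in `H²`. -/
def coeff (f : HardySpace) (n : ℕ) : ℂ := maclaurin f n

theorem hasSum_coeff (f : HardySpace) (z : 𝔻) :
    HasSum (fun n => f.coeff n * (z : ℂ) ^ n) (f z) := hasSum_maclaurin f.2.1 z

theorem memℓp_coeff (f : HardySpace) : Memℓp f.coeff 2 := by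
  refine memℓp_gen ?_
  simpa [coeff] using f.2.2

@[ext]
theorem ext {f g : HardySpace} (h : ∀ z : 𝔻, f z = g z) : f = g := Subtype.ext (funext h)

theorem coeff_add (f g : HardySpace) (n : ℕ) : (f + g).coeff n = f.coeff n + g.coeff n := by
  have h := of_hasSum (f := f + g) (a := f.coeff + g.coeff) fun z => by
    simpa [add_mul] using (f.hasSum_coeff z).add (g.hasSum_coeff z)
  exact congrFun h.2 n

theorem coeff_smul (c : ℂ) (f : HardySpace) (n : ℕ) : (c • f).coeff n = c * f.coeff n := by
  have h := of_hasSum (f := c • f.1) (a := c • f.coeff) fun z => by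
    simpa [mul_assoc] using (f.hasSum_coeff z).mul_left c
  exact congrFun h.2 n

/-- The Maclaurin coefficients identify `H²` with the space of square-summable sequences. -/
def coeffEquiv : HardySpace ≃ₗ[ℂ] lp (fun _ : ℕ => ℂ) 2 :=
  LinearEquiv.ofBijective
    { toFun := fun f => ⟨f.coeff, f.memℓp_coeff⟩
      map_add' := fun f g => by ext n; exact coeff_add f g n
      map_smul' := fun c f => by ext n; exact coeff_smul c f n }
    (by
      constructor
      · intro f g hfg
        have h : f.coeff = g.coeff := congrArg Subtype.val hfg
        ext z
        exact (f.hasSum_coeff z).unique (h ▸ g.hasSum_coeff z)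
      · intro a
        have ha : Summable fun n => ‖a n‖ ^ 2 := by
          simpa using (lp.memℓp a).summable (by norm_num)
        have hs : ∀ z : 𝔻, Summable fun n => a n * (z : ℂ) ^ n := fun z => by
          refine Summable.of_norm_bounded (g := fun n => ‖a n‖ ^ 2 + (‖(z : ℂ)‖ ^ 2) ^ n)
            (ha.add (summable_geometric_of_lt_one (by positivity) z.sq_norm_lt_one)) fun n => ?_
          rw [norm_mul, norm_pow, ← pow_mul, mul_comm 2 n, pow_mul]
          nlinarith [sq_nonneg (‖a n‖ - ‖(z : ℂ)‖ ^ n), norm_nonneg (a n),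
            pow_nonneg (norm_nonneg (z : ℂ)) n, sq_nonneg (‖a n‖), sq_nonneg (‖(z : ℂ)‖ ^ n)]
        have h := of_hasSum (f := fun z : 𝔻 => ∑' n, a n * (z : ℂ) ^ n) (a := a)
          fun z => (hs z).hasSum
        refine ⟨⟨fun z : 𝔻 => ∑' n, a n * (z : ℂ) ^ n, h.1, by rw [h.2]; exact ha⟩, ?_⟩
        ext n
        exact congrFun h.2 n)

theorem coeffEquiv_apply (f : HardySpace) (n : ℕ) : coeffEquiv f n = f.coeff n := rfl

/-- The inner product of `H²`, by Maclaurin coefficients. As usual in Mathlib it is conjugate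
linear in the first variable. -/
instance : Inner ℂ HardySpace := ⟨fun f g => ∑' n, conj (f.coeff n) * g.coeff n⟩

theorem inner_def (f g : HardySpace) :
    inner ℂ f g = ∑' n, conj (f.coeff n) * g.coeff n := rfl

theorem inner_eq (f g : HardySpace) : inner ℂ f g = inner ℂ (coeffEquiv f) (coeffEquiv g) := by
  rw [lp.inner_eq_tsum, inner_def]
  exact tsum_congr fun n => by simp [coeffEquiv_apply, mul_comm]

/-- The inner product of `H²` is positive definite. -/
@[reducible]
def core : InnerProductSpace.Core ℂ HardySpace where
  inner := fun f g => inner ℂ f g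
  conj_inner_symm f g := by simp only [inner_eq]; exact inner_conj_symm _ _
  re_inner_nonneg f := by simp only [inner_eq]; exact inner_self_nonneg
  add_left f g h := by simp only [inner_eq, map_add]; exact inner_add_left _ _ _
  smul_left f g c := by simp only [inner_eq, map_smul]; exact inner_smul_left _ _ _
  definite f hf := by
    simp only [inner_eq] at hf
    exact coeffEquiv.map_eq_zero_iff.1 (inner_self_eq_zero.1 hf)

instance : NormedAddCommGroup HardySpace :=
  @InnerProductSpace.Core.toNormedAddCommGroup ℂ HardySpace _ _ _ core

instance : InnerProductSpace ℂ HardySpace := InnerProductSpace.ofCore core.toCore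

theorem norm_coeffEquiv (f : HardySpace) : ‖coeffEquiv f‖ = ‖f‖ := by
  rw [@norm_eq_sqrt_re_inner ℂ, @norm_eq_sqrt_re_inner ℂ HardySpace]
  congr 2
  exact (inner_eq f f).symm

/-- The isometric identification of `H²` with the space of square-summable sequences. -/
def coeffIsometry : HardySpace ≃ₗᵢ[ℂ] lp (fun _ : ℕ => ℂ) 2 := ⟨coeffEquiv, norm_coeffEquiv⟩

instance : CompleteSpace HardySpace :=
  coeffIsometry.toIsometryEquiv.completeSpace

end HardySpace

end HardySpace

section CompositionOperators

/-- The bounded operator `C` on `H²` is the composition operator `g ↦ g ∘ φ`. -/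
def IsCompositionOperator (φ : RatFunc ℂ) (C : HardySpace →L[ℂ] HardySpace) : Prop :=
  ∀ (g : HardySpace) (z v : 𝔻),
    sphereMap φ ((z : ℂ) : OnePoint ℂ) = ((v : ℂ) : OnePoint ℂ) → C g z = g v

/-- The points of the open unit disc that `R` maps to `x`. -/
def discPreimage (R : RatFunc ℂ) (x : OnePoint ℂ) : Set 𝔻 :=
  {w : 𝔻 | sphereMap R ((w : ℂ) : OnePoint ℂ) = x}

end CompositionOperators

end HardyComposition

end

open scoped ComplexConjugate Complex.UnitDisc OnePoint
open Polynomial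

noncomputable section

namespace HardyComposition

/-! Let `k_w(u) = 1 / (1 - conj w * u)` be the reproducing kernel. Then `C* f (z) = ⟨f, C k_z⟩`, so
it is enough to expand `C k_z` in kernels. Write `φ_e = N / D` in lowest terms and `T = N - z D`.
Since `conj (φ u) = 1 / φ_e x` with `x = 1 / conj u`, the conjugate of `C k_z (u) = 1 / (1 - conj z
* φ u)` is `N x / T x` (`eval_num_div_eval_levelPoly_exterior`). The roots of `T` are the preimages
`w` of `z`. Regularity makes them simple, and if `T 0 ≠ 0`, partial fractions
(`eval_div_eval_eq_sum`) give `N x / T x = N 0 / T 0 + ∑ N w / (w T' w) * x / (x - w)`. Here `x / (x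
- w) = 1 / (1 - w * conj u)` is the conjugate of `k_w(u)`, so `C k_z` is a finite combination of
`k_0 = 1` and the `k_w` (`kernel_eq_sum`). Pairing with `f` gives the formula, because `N w = z D w`
and `T' w / D w = φ_e' w`. The term `N 0 / T 0` depends only on the top coefficients of `φ`, that
is, on `φ ∞`. When `φ ∞ = ∞` and `z = 0`, the origin is a root of `T`; there `C k_0 = k_0` gives the
value directly.

Boundedness of `C` is Littlewood's subordination argument. With `B` the backward shift, `G w = 2 ⟪f,
(1 - w B)⁻¹ f⟫ - ‖f‖²` (inner product linear in the second slot) is holomorphic and `|f|² ≤ Re G` on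
the disc. Hence `|f ∘ φ|² ≤ Re (G ∘ φ)`, and the mean value property bounds the sum of squared
coefficients of `f ∘ φ` by `Re G (φ 0)`. -/

theorem differentiableAt_inverse_one_sub_smul {A : Type*} [NormedRing A] [NormedAlgebra ℂ A]
    [CompleteSpace A] {a : A} {w : ℂ} (hw : ‖w • a‖ < 1) :
    DifferentiableAt ℂ (fun w : ℂ => Ring.inverse (1 - w • a)) w := by
  obtain ⟨u, hu⟩ : IsUnit (1 - w • a) := isUnit_one_sub_of_norm_lt_one hw
  have h1 : DifferentiableAt ℂ (Ring.inverse (M₀ := A)) (1 - w • a) := by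
    rw [← hu]; exact (hasFDerivAt_ringInverse u).differentiableAt
  have h2 : DifferentiableAt ℂ (fun w : ℂ => 1 - w • a) w :=
    (differentiableAt_id.smul_const a).const_sub 1
  exact DifferentiableAt.comp w h1 h2

/-! ### Reproducing kernels, the backward shift and the harmonic majorant. -/

namespace HardySpace

/-- The function in `H²` with prescribed square-summable Maclaurin coefficients. -/
def ofCoeff (a : ℕ → ℂ) (ha : Summable fun n => ‖a n‖ ^ 2) : HardySpace :=
  coeffEquiv.symm ⟨a, memℓp_gen (by simpa using ha)⟩

@[simp]
theorem coeff_ofCoeff (a : ℕ → ℂ) (ha : Summable fun n => ‖a n‖ ^ 2) (n : ℕ) :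
    (ofCoeff a ha).coeff n = a n := by
  rw [← coeffEquiv_apply, ofCoeff, LinearEquiv.apply_symm_apply]

theorem ext_coeff {f g : HardySpace} (h : ∀ n, f.coeff n = g.coeff n) : f = g :=
  coeffEquiv.injective (by ext n; exact h n)

theorem summable_coeff (f : HardySpace) : Summable fun n => ‖f.coeff n‖ ^ 2 := f.2.2

theorem norm_sq_eq_tsum (f : HardySpace) : ‖f‖ ^ 2 = ∑' n, ‖f.coeff n‖ ^ 2 := by
  have h : ((‖f‖ ^ 2 : ℝ) : ℂ) = inner ℂ f f := by
    rw [inner_self_eq_norm_sq_to_K]; simp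
  rw [inner_def] at h
  have e : ∀ n, conj (f.coeff n) * f.coeff n = ((‖f.coeff n‖ ^ 2 : ℝ) : ℂ) := fun n => by
    rw [Complex.conj_mul']; simp
  simp only [e] at h
  exact_mod_cast h

theorem add_apply (f g : HardySpace) (z : 𝔻) : (f + g) z = f z + g z := rfl

theorem smul_apply (c : ℂ) (f : HardySpace) (z : 𝔻) : (c • f) z = c * f z := rfl

theorem sub_apply (f g : HardySpace) (z : 𝔻) : (f - g) z = f z - g z := rfl

theorem sum_apply {ι : Type*} (s : Finset ι) (f : ι → HardySpace) (z : 𝔻) :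
    (∑ i ∈ s, f i) z = ∑ i ∈ s, f i z := by
  classical
  induction s using Finset.induction_on with
  | empty => simp only [Finset.sum_empty]; rfl
  | insert i s hi ih => rw [Finset.sum_insert hi, Finset.sum_insert hi, add_apply, ih]

/-- The reproducing kernel of `H²`. -/
def kernel (w : 𝔻) : HardySpace :=
  ofCoeff (fun n => conj (w : ℂ) ^ n) (by
    simp only [norm_pow, RCLike.norm_conj, ← pow_mul, mul_comm _ 2]
    simp only [pow_mul]
    exact summable_geometric_of_lt_one (by positivity) w.sq_norm_lt_one)

theorem inner_kernel (w : 𝔻) (f : HardySpace) : inner ℂ (kernel w) f = f w := by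
  rw [inner_def, ← (f.hasSum_coeff w).tsum_eq]
  exact tsum_congr fun n => by simp [kernel, mul_comm]

theorem kernel_apply (w u : 𝔻) : kernel w u = (1 - conj (w : ℂ) * u)⁻¹ := by
  have h := (kernel w).hasSum_coeff u
  simp only [kernel, coeff_ofCoeff, ← mul_pow] at h
  refine h.unique (hasSum_geometric_of_norm_lt_one ?_)
  rw [norm_mul, RCLike.norm_conj]
  exact mul_lt_one_of_nonneg_of_lt_one_left (norm_nonneg _) w.norm_lt_one u.norm_lt_one.le

/-- The backward shift on `H²`, as a linear map. -/
def backwardShiftLinear : HardySpace →ₗ[ℂ] HardySpace where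
  toFun f := ofCoeff (fun n => f.coeff (n + 1)) ((summable_nat_add_iff 1).2 f.summable_coeff)
  map_add' f g := ext_coeff fun n => by simp [coeff_add]
  map_smul' c f := ext_coeff fun n => by simp [coeff_smul]

theorem coeff_backwardShiftLinear (f : HardySpace) (n : ℕ) :
    (backwardShiftLinear f).coeff n = f.coeff (n + 1) := by simp [backwardShiftLinear]

theorem norm_sq_backwardShiftLinear (f : HardySpace) :
    ‖backwardShiftLinear f‖ ^ 2 + ‖f.coeff 0‖ ^ 2 = ‖f‖ ^ 2 := by
  rw [norm_sq_eq_tsum, norm_sq_eq_tsum, f.summable_coeff.tsum_eq_zero_add]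
  simp only [coeff_backwardShiftLinear]
  ring

/-- The backward shift on `H²`. -/
def backwardShift : HardySpace →L[ℂ] HardySpace :=
  backwardShiftLinear.mkContinuous 1 fun f => by
    rw [one_mul]
    refine le_of_sq_le_sq ?_ (norm_nonneg _)
    have := norm_sq_backwardShiftLinear f
    nlinarith [sq_nonneg ‖f.coeff 0‖]

theorem norm_backwardShift_le : ‖backwardShift‖ ≤ 1 :=
  LinearMap.mkContinuous_norm_le _ zero_le_one _

theorem norm_sq_backwardShift (f : HardySpace) :
    ‖backwardShift f‖ ^ 2 + ‖f.coeff 0‖ ^ 2 = ‖f‖ ^ 2 :=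
  norm_sq_backwardShiftLinear f

theorem mul_backwardShift_apply (f : HardySpace) (z : 𝔻) :
    (z : ℂ) * backwardShift f z = f z - f.coeff 0 := by
  have h1 := ((backwardShift f).hasSum_coeff z).mul_left (z : ℂ)
  have h2 := (hasSum_nat_add_iff' 1).2 (f.hasSum_coeff z)
  simp only [Finset.range_one, Finset.sum_singleton, pow_zero, mul_one] at h2
  have e : ∀ n, (z : ℂ) * ((backwardShift f).coeff n * (z : ℂ) ^ n) =
      f.coeff (n + 1) * (z : ℂ) ^ (n + 1) := fun n => by
    rw [show (backwardShift f).coeff n = f.coeff (n + 1) from coeff_backwardShiftLinear f n]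
    ring
  simp only [e] at h1
  exact h1.unique h2

theorem norm_smul_backwardShift_lt {w : ℂ} (hw : ‖w‖ < 1) : ‖w • backwardShift‖ < 1 := by
  rw [norm_smul]
  exact mul_lt_one_of_nonneg_of_lt_one_left (norm_nonneg _) hw norm_backwardShift_le

/-- The resolvent `(1 - w B)⁻¹ f` of the backward shift `B`. -/
def shiftResolvent (f : HardySpace) (w : ℂ) : HardySpace :=
  Ring.inverse (1 - w • backwardShift) f

theorem shiftResolvent_sub (f : HardySpace) {w : ℂ} (hw : ‖w‖ < 1) :
    shiftResolvent f w - w • backwardShift (shiftResolvent f w) = f := by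
  have hu : IsUnit (1 - w • backwardShift) :=
    isUnit_one_sub_of_norm_lt_one (norm_smul_backwardShift_lt hw)
  have := congrArg (fun T : HardySpace →L[ℂ] HardySpace => T f) (Ring.mul_inverse_cancel _ hu)
  simpa [shiftResolvent] using this

theorem differentiableAt_shiftResolvent (f : HardySpace) {w : ℂ} (hw : ‖w‖ < 1) :
    DifferentiableAt ℂ (shiftResolvent f) w :=
  (differentiableAt_inverse_one_sub_smul (norm_smul_backwardShift_lt hw)).clm_apply
    (differentiableAt_const f)

/-- Evaluate `g - z B g = f` at `z` itself: since `z * (B g) z = g z - g.coeff 0`, only the constant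
coefficient of `g` survives. -/
theorem coeff_zero_shiftResolvent (f : HardySpace) (z : 𝔻) :
    (shiftResolvent f z).coeff 0 = f z := by
  have h := shiftResolvent_sub f z.norm_lt_one
  have h1 : (shiftResolvent f z) z - (z : ℂ) * backwardShift (shiftResolvent f z) z = f z :=
    congrArg (fun g : HardySpace => g z) h
  rw [mul_backwardShift_apply] at h1
  simpa using h1

theorem norm_shiftResolvent_le (f : HardySpace) {w : ℂ} (hw : ‖w‖ < 1) :
    ‖shiftResolvent f w‖ ≤ ‖f‖ / (1 - ‖w‖) := by
  rw [le_div_iff₀ (by linarith)]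
  have h := shiftResolvent_sub f hw
  set g := shiftResolvent f w
  have h1 : g = f + w • backwardShift g := by rw [← h]; abel
  have h2 : ‖g‖ ≤ ‖f‖ + ‖w‖ * ‖g‖ := by
    calc ‖g‖ = ‖f + w • backwardShift g‖ := by rw [← h1]
      _ ≤ ‖f‖ + ‖w • backwardShift g‖ := norm_add_le _ _
      _ ≤ _ := by
        rw [norm_smul]
        have := backwardShift.le_of_opNorm_le norm_backwardShift_le g
        rw [one_mul] at this
        gcongr
  linarith

/-- A holomorphic function whose real part is a harmonic majorant of `|f|²`. -/
def majorant (f : HardySpace) (w : ℂ) : ℂ :=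
  2 * inner ℂ f (shiftResolvent f w) - (‖f‖ ^ 2 : ℝ)

theorem differentiableAt_majorant (f : HardySpace) {w : ℂ} (hw : ‖w‖ < 1) :
    DifferentiableAt ℂ f.majorant w := by
  have h := ((innerSL ℂ f).differentiableAt (x := shiftResolvent f w)).comp w
    (differentiableAt_shiftResolvent f hw)
  exact (h.const_mul 2).sub_const _

/-- With `g = (1 - z B)⁻¹ f`, one has `g - f = z B g` and `‖B g‖² = ‖g‖² - |f z|²`. Expanding `‖g -
f‖²` shows that the real part equals `|f z|² + (1 - |z|²) ‖B g‖²`. -/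
theorem norm_sq_le_re_majorant (f : HardySpace) (z : 𝔻) :
    ‖f z‖ ^ 2 ≤ (f.majorant z).re := by
  have h := shiftResolvent_sub f z.norm_lt_one
  have h0 := coeff_zero_shiftResolvent f z
  set g := shiftResolvent f z with hg
  have h1 : ‖g - f‖ ^ 2 = ‖(z : ℂ)‖ ^ 2 * ‖backwardShift g‖ ^ 2 := by
    rw [← mul_pow, ← norm_smul]
    congr 2
    exact sub_eq_of_eq_add ((sub_eq_iff_eq_add'.1 h))
  have h2 := norm_sub_sq (𝕜 := ℂ) g f
  have h3 := norm_sq_backwardShift g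
  have h4 : (f.majorant z).re = 2 * RCLike.re (inner ℂ g f) - ‖f‖ ^ 2 := by
    rw [majorant, ← hg, inner_re_symm]
    simp [-Complex.ofReal_pow]
  rw [h0] at h3
  rw [h4]
  have h5 := z.sq_norm_lt_one
  nlinarith [mul_nonneg (sub_nonneg.2 h5.le) (sq_nonneg ‖backwardShift g‖)]

theorem re_majorant_le (f : HardySpace) {w : ℂ} (hw : ‖w‖ < 1) :
    (f.majorant w).re ≤ 2 / (1 - ‖w‖) * ‖f‖ ^ 2 := by
  have h1 : (inner ℂ f (shiftResolvent f w)).re ≤ ‖f‖ * (‖f‖ / (1 - ‖w‖)) :=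
    (Complex.re_le_norm _).trans ((norm_inner_le_norm _ _).trans
      (by gcongr; exact norm_shiftResolvent_le f hw))
  have h2 : (f.majorant w).re = 2 * (inner ℂ f (shiftResolvent f w)).re - ‖f‖ ^ 2 := by
    rw [majorant]; simp [-Complex.ofReal_pow]
  rw [h2]
  have : 2 / (1 - ‖w‖) * ‖f‖ ^ 2 = 2 * (‖f‖ * (‖f‖ / (1 - ‖w‖))) := by ring
  rw [this]
  nlinarith [sq_nonneg ‖f‖]

end HardySpace

/-! ### Circle averages and a majorant criterion for membership in `H²`. -/

open Real (circleAverage)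

theorem extendZero_of_lt (f : 𝔻 → ℂ) {w : ℂ} (hw : ‖w‖ < 1) :
    extendZero f w = f (Complex.UnitDisc.mk w hw) := by simp [extendZero, hw]

theorem closedBall_subset_unit_ball {r : ℝ} (hr : r < 1) :
    Metric.closedBall (0 : ℂ) r ⊆ Metric.ball 0 1 := Metric.closedBall_subset_ball hr

theorem IsHolomorphic.continuousOn_sphere {f : 𝔻 → ℂ} (hf : IsHolomorphic f) {r : ℝ}
    (hr : r < 1) : ContinuousOn (extendZero f) (Metric.sphere 0 r) :=
  hf.continuousOn.mono (Metric.sphere_subset_closedBall.trans (closedBall_subset_unit_ball hr))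

/-- On the circle `conj z = r² / z`, which turns the average into Cauchy's integral for the `n`-th
coefficient. -/
theorem circleAverage_conj_pow_mul {f : 𝔻 → ℂ} (hf : IsHolomorphic f) {r : ℝ} (h0 : 0 < r)
    (h1 : r < 1) (n : ℕ) :
    circleAverage (fun z => conj z ^ n * extendZero f z) 0 r = (r : ℂ) ^ (2 * n) * maclaurin f n := by
  have h := DifferentiableOn.circleIntegral_one_div_sub_center_pow_smul h0 n
    (hf.mono (closedBall_subset_unit_ball h1))
  have e : circleAverage (fun z => conj z ^ n * extendZero f z) 0 r =
      circleAverage (fun z => ((r : ℂ) ^ (2 * n)) • ((z ^ n)⁻¹ * extendZero f z)) 0 r := by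
    refine Real.circleAverage_congr_sphere fun z hz => ?_
    have hz : ‖z‖ = r := by simpa [abs_of_pos h0] using hz
    have hz0 : z ≠ 0 := by rw [← norm_pos_iff, hz]; exact h0
    have : conj z = (r : ℂ) ^ 2 * z⁻¹ := by
      rw [← hz, ← Complex.conj_mul', mul_assoc, mul_inv_cancel₀ hz0, mul_one]
    simp only [this, smul_eq_mul]
    rw [mul_pow, ← pow_mul, inv_pow, mul_assoc]
  rw [e, Real.circleAverage_fun_smul, Real.circleAverage_eq_circleIntegral h0.ne', smul_eq_mul]
  congr 1
  have e2 : (∮ z in C(0, r), (z - 0)⁻¹ • ((z ^ n)⁻¹ * extendZero f z)) =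
      ∮ z in C(0, r), (1 / (z - 0) ^ (n + 1)) • extendZero f z := by
    congr 1
    funext z
    simp only [sub_zero, smul_eq_mul, pow_succ, one_div, mul_inv]
    ring
  rw [e2, h, maclaurin, smul_eq_mul, smul_eq_mul]
  have : (2 * (Real.pi : ℂ) * Complex.I) ≠ 0 := Complex.two_pi_I_ne_zero
  field_simp

theorem circleAverage_re {g : ℂ → ℂ} {r : ℝ} (hg : CircleIntegrable g 0 r) :
    circleAverage (fun z => (g z).re) 0 r = (circleAverage g 0 r).re :=
  Complex.reCLM.circleAverage_comp_comm hg

theorem circleAverage_conj_sum_mul {f : 𝔻 → ℂ} (hf : IsHolomorphic f) {r : ℝ} (h0 : 0 < r)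
    (h1 : r < 1) (N : ℕ) (b : ℕ → ℂ) :
    circleAverage (fun z => conj (∑ n ∈ Finset.range N, b n * z ^ n) * extendZero f z) 0 r =
      ∑ n ∈ Finset.range N, (r : ℂ) ^ (2 * n) * (conj (b n) * maclaurin f n) := by
  have hc := hf.continuousOn_sphere h1
  have e : (fun z => conj (∑ n ∈ Finset.range N, b n * z ^ n) * extendZero f z) =
      fun z => ∑ n ∈ Finset.range N, conj (b n) • (conj z ^ n * extendZero f z) := by
    funext z
    simp [Finset.sum_mul, mul_assoc]
  rw [e, Real.circleAverage_fun_sum]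
  · refine Finset.sum_congr rfl fun n _ => ?_
    rw [Real.circleAverage_fun_smul, circleAverage_conj_pow_mul hf h0 h1, smul_eq_mul]
    ring
  · intro n _
    refine ContinuousOn.circleIntegrable h0.le ?_
    have hz : Continuous fun z : ℂ => conj z ^ n := Complex.continuous_conj.pow n
    exact continuousOn_const.mul (hz.continuousOn.mul hc)

/-- Bessel's inequality on a circle inside the disc. -/
theorem sum_norm_sq_maclaurin_le_circleAverage {f : 𝔻 → ℂ} (hf : IsHolomorphic f) {r : ℝ}
    (h0 : 0 < r) (h1 : r < 1) (N : ℕ) :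
    ∑ n ∈ Finset.range N, r ^ (2 * n) * ‖maclaurin f n‖ ^ 2 ≤
      circleAverage (fun z => ‖extendZero f z‖ ^ 2) 0 r := by
  set b := maclaurin f with hb
  let P : ℂ → ℂ := fun z => ∑ n ∈ Finset.range N, b n * z ^ n
  have hP : Continuous P := by fun_prop
  -- The Taylor polynomial is also viewed as a function on the disc, so that the average of `|P|² =
  -- conj P * p` falls under the same formula as that of `conj P * f`.
  let p : 𝔻 → ℂ := fun z => P z
  have hp := of_hasSum (f := p) (a := fun n => if n ∈ Finset.range N then b n else 0) fun z => by
    have := hasSum_sum_of_ne_finset_zero (s := Finset.range N)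
      (f := fun n => (if n ∈ Finset.range N then b n else 0) * (z : ℂ) ^ n)
      (fun n hn => by rw [if_neg hn, zero_mul]) (L := .unconditional ℕ)
    convert this using 1
    exact Finset.sum_congr rfl fun n hn => by rw [if_pos hn]
  have hpP : ∀ z ∈ Metric.sphere (0 : ℂ) r, extendZero p z = P z := fun z hz => by
    rw [extendZero_of_lt p (w := z) (by rw [mem_sphere_zero_iff_norm.1 hz]; exact h1)]
    rfl
  have hc := hf.continuousOn_sphere h1
  have i1 : ContinuousOn (fun z => conj (P z) * extendZero f z) (Metric.sphere 0 r) :=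
    (Complex.continuous_conj.comp hP).continuousOn.mul hc
  have i2 : ContinuousOn (fun z => conj (P z) * extendZero p z) (Metric.sphere 0 r) :=
    (Complex.continuous_conj.comp hP).continuousOn.mul (hp.1.continuousOn_sphere h1)
  have key : ∀ g : 𝔻 → ℂ, IsHolomorphic g → (∀ n ∈ Finset.range N, maclaurin g n = b n) →
      (circleAverage (fun z => conj (P z) * extendZero g z) 0 r).re =
        ∑ n ∈ Finset.range N, r ^ (2 * n) * ‖b n‖ ^ 2 := fun g hg hgb => by
    have e : ∑ n ∈ Finset.range N, (r : ℂ) ^ (2 * n) * (conj (b n) * maclaurin g n) =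
        ((∑ n ∈ Finset.range N, r ^ (2 * n) * ‖b n‖ ^ 2 : ℝ) : ℂ) := by
      push_cast
      refine Finset.sum_congr rfl fun n hn => ?_
      rw [hgb n hn, Complex.conj_mul']
    rw [circleAverage_conj_sum_mul hg h0 h1, e, Complex.ofReal_re]
  have k1 := key f hf fun n _ => rfl
  have k2 := key p hp.1 fun n hn => by rw [hp.2]; exact if_pos hn
  rw [← circleAverage_re (i1.circleIntegrable h0.le)] at k1
  rw [← circleAverage_re (i2.circleIntegrable h0.le)] at k2
  have j1 : ContinuousOn (fun z => (conj (P z) * extendZero f z).re) (Metric.sphere 0 r) :=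
    Complex.continuous_re.comp_continuousOn i1
  have j2 : ContinuousOn (fun z => (conj (P z) * extendZero p z).re) (Metric.sphere 0 r) :=
    Complex.continuous_re.comp_continuousOn i2
  have j3 : ContinuousOn (fun z => (2 : ℝ) • (conj (P z) * extendZero f z).re)
    (Metric.sphere 0 r) := j1.const_smul (2 : ℝ)
  have h := Real.circleAverage_mono (c := 0) (R := r)
    (f₁ := fun z => ((2 : ℝ) • (conj (P z) * extendZero f z).re) -
      (conj (P z) * extendZero p z).re)
    (f₂ := fun z => ‖extendZero f z‖ ^ 2)
    ((j3.sub j2).circleIntegrable h0.le)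
    ((hc.norm.pow 2).circleIntegrable h0.le) fun z hz => by
      rw [abs_of_pos h0] at hz
      rw [hpP z hz]
      -- Pointwise, `2 Re (conj P * f) - |P|² ≤ |f|²`; the averages of `Re (conj P * f)` and of
      -- `|P|²` are the same sum.
      have := sq_nonneg ‖extendZero f z - P z‖
      rw [← Complex.normSq_eq_norm_sq, Complex.normSq_apply] at this
      simp only [← Complex.normSq_eq_norm_sq, Complex.normSq_apply, smul_eq_mul, Complex.mul_re,
        Complex.conj_re, Complex.conj_im, Complex.sub_re, Complex.sub_im] at this ⊢
      nlinarith
  rw [Real.circleAverage_fun_sub (j3.circleIntegrable h0.le)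
    (j2.circleIntegrable h0.le), Real.circleAverage_fun_smul, k1, k2, smul_eq_mul] at h
  linarith

/-- A holomorphic function whose squared modulus has the real part of a holomorphic function `G`
as a majorant is in `H²`, with norm controlled by `G 0`. -/
theorem summable_of_norm_sq_le_re {f : 𝔻 → ℂ} (hf : IsHolomorphic f) {G : ℂ → ℂ}
    (hG : DifferentiableOn ℂ G (Metric.ball 0 1)) (h : ∀ z : 𝔻, ‖f z‖ ^ 2 ≤ (G z).re) :
    (Summable fun n => ‖maclaurin f n‖ ^ 2) ∧ ∑' n, ‖maclaurin f n‖ ^ 2 ≤ (G 0).re := by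
  have hb : ∀ N, ∑ n ∈ Finset.range N, ‖maclaurin f n‖ ^ 2 ≤ (G 0).re := fun N => by
    have hr : ∀ r ∈ Set.Ioo (0 : ℝ) 1,
        ∑ n ∈ Finset.range N, r ^ (2 * n) * ‖maclaurin f n‖ ^ 2 ≤ (G 0).re := fun r hr => by
      have hGc : ContinuousOn G (Metric.sphere 0 r) := hG.continuousOn.mono
        (Metric.sphere_subset_closedBall.trans (closedBall_subset_unit_ball hr.2))
      refine (sum_norm_sq_maclaurin_le_circleAverage hf hr.1 hr.2 N).trans ?_
      have hm : circleAverage G 0 r = G 0 := by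
        refine DiffContOnCl.circleAverage ?_
        rw [abs_of_pos hr.1]
        refine (hG.mono ?_).diffContOnCl
        exact Metric.closure_ball_subset_closedBall.trans (closedBall_subset_unit_ball hr.2)
      rw [← hm, ← circleAverage_re (hGc.circleIntegrable hr.1.le)]
      refine Real.circleAverage_mono
        (((hf.continuousOn_sphere hr.2).norm.pow 2).circleIntegrable hr.1.le)
        ((Complex.continuous_re.comp_continuousOn hGc).circleIntegrable hr.1.le) fun z hz => ?_
      rw [abs_of_pos hr.1, mem_sphere_zero_iff_norm] at hz
      have hz1 : ‖z‖ < 1 := hz ▸ hr.2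
      rw [extendZero_of_lt f hz1]
      exact h (Complex.UnitDisc.mk z hz1)
    -- For fixed `N` the weighted sum is a polynomial in `r`, so the bound survives the limit `r →
    -- 1`.
    have hc : Continuous fun r : ℝ =>
        ∑ n ∈ Finset.range N, r ^ (2 * n) * ‖maclaurin f n‖ ^ 2 := by fun_prop
    have ht := (hc.tendsto 1).mono_left (nhdsWithin_le_nhds (s := Set.Iio 1))
    simp only [one_pow, one_mul] at ht
    exact le_of_tendsto ht (by
      filter_upwards [Ioo_mem_nhdsLT zero_lt_one] with r h using hr r h)
  have hs := summable_of_sum_range_le (fun n => by positivity) hb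
  exact ⟨hs, hs.tsum_le_of_sum_range_le hb⟩

/-! ### Rational selfmaps of the disc and their composition operators. -/

theorem coe_unitDisc_injective {v w : 𝔻} (h : ((v : ℂ) : OnePoint ℂ) = ((w : ℂ) : OnePoint ℂ)) :
    v = w := Complex.UnitDisc.coe_injective (OnePoint.coe_injective h)

theorem sphereMap_coe_eq_coe {R : RatFunc ℂ} {w v : ℂ} :
    sphereMap R (w : OnePoint ℂ) = (v : OnePoint ℂ) ↔
      R.denom.eval w ≠ 0 ∧ R.num.eval w / R.denom.eval w = v := by
  by_cases h : R.denom.eval w = 0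
  · simp [sphereMap, h]
  · simp [sphereMap, finiteMap, h]

namespace MapsDisc

variable {φ : RatFunc ℂ}

/-- The selfmap of the disc given by a rational function that maps the disc into itself. -/
def discMap (hφ : MapsDisc φ) (z : 𝔻) : 𝔻 := (hφ z).choose

theorem sphereMap_eq (hφ : MapsDisc φ) (z : 𝔻) :
    sphereMap φ ((z : ℂ) : OnePoint ℂ) = ((hφ.discMap z : ℂ) : OnePoint ℂ) := (hφ z).choose_spec

theorem denom_ne_zero (hφ : MapsDisc φ) {w : ℂ} (hw : ‖w‖ < 1) : φ.denom.eval w ≠ 0 :=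
  (sphereMap_coe_eq_coe.1 (hφ.sphereMap_eq (Complex.UnitDisc.mk w hw))).1

theorem coe_discMap (hφ : MapsDisc φ) (z : 𝔻) : (hφ.discMap z : ℂ) = finiteMap φ z :=
  (sphereMap_coe_eq_coe.1 (hφ.sphereMap_eq z)).2.symm

theorem norm_finiteMap_lt (hφ : MapsDisc φ) {w : ℂ} (hw : ‖w‖ < 1) : ‖finiteMap φ w‖ < 1 := by
  have h := hφ.coe_discMap (Complex.UnitDisc.mk w hw)
  rw [Complex.UnitDisc.coe_mk] at h
  rw [← h]
  exact Complex.UnitDisc.norm_lt_one _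

theorem differentiableAt_finiteMap (hφ : MapsDisc φ) {w : ℂ} (hw : ‖w‖ < 1) :
    DifferentiableAt ℂ (finiteMap φ) w :=
  φ.num.differentiableAt.div φ.denom.differentiableAt (hφ.denom_ne_zero hw)

theorem isHolomorphic_comp (hφ : MapsDisc φ) {f : 𝔻 → ℂ} (hf : IsHolomorphic f) :
    IsHolomorphic fun z => f (hφ.discMap z) := by
  have h : DifferentiableOn ℂ (fun w => extendZero f (finiteMap φ w)) (Metric.ball 0 1) :=
    DifferentiableOn.comp (t := Metric.ball 0 1) hf
      (fun w hw => (hφ.differentiableAt_finiteMap (by simpa using hw)).differentiableWithinAt)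
      fun w hw => by simpa using hφ.norm_finiteMap_lt (by simpa using hw)
  refine h.congr fun w hw => ?_
  have hw : ‖w‖ < 1 := by simpa using hw
  rw [extendZero_of_lt _ hw, ← extendZero_coe f, coe_discMap, Complex.UnitDisc.coe_mk]

/-- Composing the majorant of `f` with `φ` gives a holomorphic majorant of `f ∘ φ`, whose value at
the origin is the majorant of `f` at `φ 0`. -/
theorem summable_comp (hφ : MapsDisc φ) (f : HardySpace) :
    (Summable fun n => ‖maclaurin (fun z => f (hφ.discMap z)) n‖ ^ 2) ∧
      ∑' n, ‖maclaurin (fun z => f (hφ.discMap z)) n‖ ^ 2 ≤ (f.majorant (finiteMap φ 0)).re :=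
  summable_of_norm_sq_le_re (hφ.isHolomorphic_comp f.2.1) (G := fun w => f.majorant (finiteMap φ w))
    (fun w hw => by
      have hw : ‖w‖ < 1 := by simpa using hw
      exact (DifferentiableAt.comp w (HardySpace.differentiableAt_majorant f
        (hφ.norm_finiteMap_lt hw)) (hφ.differentiableAt_finiteMap hw)).differentiableWithinAt)
    fun z => by
      rw [← hφ.coe_discMap]
      exact f.norm_sq_le_re_majorant _

/-- The composition operator, as a linear map. -/
def compositionLinear (hφ : MapsDisc φ) : HardySpace →ₗ[ℂ] HardySpace where
  toFun f := ⟨fun z => f (hφ.discMap z), hφ.isHolomorphic_comp f.2.1, (hφ.summable_comp f).1⟩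
  map_add' _ _ := rfl
  map_smul' _ _ := rfl

/-- The composition operator on `H²`. -/
def composition (hφ : MapsDisc φ) : HardySpace →L[ℂ] HardySpace :=
  hφ.compositionLinear.mkContinuous (Real.sqrt (2 / (1 - ‖finiteMap φ 0‖))) fun f => by
    have h0 : ‖finiteMap φ 0‖ < 1 := hφ.norm_finiteMap_lt (by simp)
    have h : ‖hφ.compositionLinear f‖ ^ 2 ≤ 2 / (1 - ‖finiteMap φ 0‖) * ‖f‖ ^ 2 := by
      rw [HardySpace.norm_sq_eq_tsum]
      exact (hφ.summable_comp f).2.trans (f.re_majorant_le h0)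
    rw [← Real.sqrt_sq (norm_nonneg f), ← Real.sqrt_mul
      (div_nonneg zero_le_two (sub_nonneg.2 h0.le))]
    exact Real.le_sqrt_of_sq_le h

theorem isCompositionOperator_composition (hφ : MapsDisc φ) : IsCompositionOperator φ hφ.composition := by
  intro g z v h
  rw [hφ.sphereMap_eq] at h
  rw [← coe_unitDisc_injective h]
  rfl

theorem existsUnique_isCompositionOperator (hφ : MapsDisc φ) :
    ∃! C : HardySpace →L[ℂ] HardySpace, IsCompositionOperator φ C := by
  refine ⟨hφ.composition, hφ.isCompositionOperator_composition, fun C hC => ?_⟩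
  ext f z
  rw [hC f z _ (hφ.sphereMap_eq z),
    hφ.isCompositionOperator_composition f z _ (hφ.sphereMap_eq z)]

/-- A rational selfmap of the open disc maps the closed disc into itself. -/
theorem denom_ne_zero_and_norm_finiteMap_le (hφ : MapsDisc φ) {w : ℂ} (hw : ‖w‖ ≤ 1) :
    φ.denom.eval w ≠ 0 ∧ ‖finiteMap φ w‖ ≤ 1 := by
  have hle : ‖φ.num.eval w‖ ≤ ‖φ.denom.eval w‖ := by
    have hcl : w ∈ closure (Metric.ball (0 : ℂ) 1) := by
      rw [closure_ball _ one_ne_zero]; simpa using hw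
    refine closure_minimal (s := Metric.ball (0 : ℂ) 1)
      (t := {w | ‖φ.num.eval w‖ ≤ ‖φ.denom.eval w‖}) (fun u hu => ?_)
      (isClosed_le φ.num.continuous.norm φ.denom.continuous.norm) hcl
    have hu : ‖u‖ < 1 := by simpa using hu
    have h := hφ.norm_finiteMap_lt hu
    rw [finiteMap, norm_div, div_lt_one (norm_pos_iff.2 (hφ.denom_ne_zero hu))] at h
    exact h.le
  -- The inequality `|p| ≤ |q|` passes to the closed disc, so a zero of `q` there would be a common
  -- zero of `p` and `q`.
  have hq : φ.denom.eval w ≠ 0 := fun h0 => by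
    rw [h0, norm_zero, norm_le_zero_iff] at hle
    have := (isCoprime_iff_aeval_ne_zero_of_isAlgClosed ℂ ℂ _ _).1 φ.isCoprime_num_denom w
    simp [hle, h0] at this
  refine ⟨hq, ?_⟩
  rw [finiteMap, norm_div]
  exact div_le_one_of_le₀ hle (norm_nonneg _)

/-- Under the exterior map, the points over the open disc lie in the open disc. -/
theorem exists_eq_coe_of_sphereMap_exterior (hφ : MapsDisc φ) (h0 : φ ≠ 0) {x : OnePoint ℂ}
    {z : 𝔻}
    (h : sphereMap (exterior φ) x = ((z : ℂ) : OnePoint ℂ)) :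
    ∃ w : 𝔻, x = ((w : ℂ) : OnePoint ℂ) := by
  by_contra hx
  -- Inversion sends the complement of the open disc into the closed disc, which `φ` preserves;
  -- inverting back gives a value outside the open disc.
  have hu : ∃ u : ℂ, ‖u‖ ≤ 1 ∧ inversion x = (u : OnePoint ℂ) := by
    induction x using OnePoint.rec with
    | infty => exact ⟨0, by simp, rfl⟩
    | coe w =>
      have hw : 1 ≤ ‖w‖ := not_lt.1 fun hw => hx ⟨Complex.UnitDisc.mk w hw, rfl⟩
      have hw0 : w ≠ 0 := norm_pos_iff.1 (by linarith)
      refine ⟨1 / conj w, ?_, by simp [inversion, hw0]⟩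
      rw [norm_div, norm_one, RCLike.norm_conj]
      exact div_le_one_of_le₀ hw (norm_nonneg _)
  obtain ⟨u, hu, hxu⟩ := hu
  obtain ⟨hq, hn⟩ := hφ.denom_ne_zero_and_norm_finiteMap_le hu
  have e : sphereMap φ (u : OnePoint ℂ) = (finiteMap φ u : OnePoint ℂ) := by
    simp [sphereMap, hq]
  rw [sphereMap_exterior φ h0, hxu, e] at h
  by_cases hv : finiteMap φ u = 0
  · simp [inversion, hv] at h
  · have h2 : 1 / conj (finiteMap φ u) = (z : ℂ) := by
      simpa only [inversion, hv, if_false, OnePoint.coe_eq_coe] using h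
    have h3 := z.norm_lt_one
    rw [← h2, norm_div, norm_one, RCLike.norm_conj, div_lt_one (norm_pos_iff.2 hv)] at h3
    linarith

end MapsDisc

/-! ### Partial fractions by Lagrange interpolation. -/

section PartialFractions

variable {ι : Type*} {s : Finset ι} {v : ι → ℂ} {T : ℂ[X]}

theorem eq_C_mul_nodal (hv : Set.InjOn v s) (hT0 : T ≠ 0) (hT : T.natDegree = s.card)
    (hr : ∀ i ∈ s, T.eval (v i) = 0) : T = C T.leadingCoeff * Lagrange.nodal s v := by
  have hl : T.leadingCoeff ≠ 0 := leadingCoeff_ne_zero.2 hT0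
  have hd : T.degree = s.card := by rw [degree_eq_natDegree hT0, hT]
  refine eq_of_degree_sub_lt_of_eval_index_eq s hv ?_ fun i hi => ?_
  · rw [← hd]
    refine degree_sub_lt_left ?_ hT0 ?_
    · rw [degree_C_mul hl, Lagrange.degree_nodal, hd]
    · rw [leadingCoeff_mul, leadingCoeff_C, Lagrange.nodal_monic.leadingCoeff, mul_one]
  · rw [hr i hi, eval_mul, Lagrange.eval_nodal_at_node hi, mul_zero]

/-- As many distinct roots as the degree forces every root to be simple. -/
theorem eval_derivative_ne_zero (hv : Set.InjOn v s) (hT0 : T ≠ 0) (hT : T.natDegree = s.card)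
    (hr : ∀ i ∈ s, T.eval (v i) = 0) {i : ι} (hi : i ∈ s) :
    T.derivative.eval (v i) ≠ 0 := by
  classical
  have h := Lagrange.nodalWeight_ne_zero hv hi
  rw [Lagrange.nodalWeight_eq_eval_derivative_nodal hi, Ne, inv_eq_zero] at h
  rw [eq_C_mul_nodal hv hT0 hT hr]
  simpa [hT0] using h

/-- Partial fractions of a quotient of polynomials whose denominator has simple nonzero roots. -/
theorem eval_div_eval_eq_sum (hv : Set.InjOn v s) (hs : s.Nonempty) (hT : T.natDegree = s.card)
    (hr : ∀ i ∈ s, T.eval (v i) = 0) (hT0 : T.eval 0 ≠ 0) {N : ℂ[X]}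
    (hN : N.natDegree ≤ s.card) {x : ℂ} (hx : ∀ i ∈ s, x ≠ v i) :
    N.eval x / T.eval x = N.eval 0 / T.eval 0 +
      ∑ i ∈ s, N.eval (v i) / (v i * T.derivative.eval (v i)) * (x / (x - v i)) := by
  classical
  have hTne : T ≠ 0 := by rintro rfl; simp at hT0
  have hl : T.leadingCoeff ≠ 0 := leadingCoeff_ne_zero.2 hTne
  -- `N` may have the same degree as `T`. Subtracting `A * T` makes it vanish at `0`; dividing by
  -- `X` leaves `M` of degree below the number of nodes, so `M` is its own interpolant. The factor
  -- `x` removed here reappears in `x / (x - v i)`.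
  set A := N.eval 0 / T.eval 0 with hA
  set M := (N - C A * T).divX with hM
  have hNM : N - C A * T = X * M := by
    have h := X_mul_divX_add (N - C A * T)
    have h0 : (N - C A * T).coeff 0 = 0 := by
      rw [coeff_zero_eq_eval_zero, eval_sub, eval_mul, eval_C, hA, div_mul_cancel₀ _ hT0, sub_self]
    rw [h0, C_0, add_zero] at h
    exact h.symm
  have hMd : M.degree < s.card := by
    have h1 : (N - C A * T).natDegree ≤ s.card :=
      (natDegree_sub_le _ _).trans (max_le hN ((natDegree_C_mul_le _ _).trans hT.le))
    have h2 : M.natDegree ≤ s.card - 1 := by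
      rw [hM, natDegree_divX_eq_natDegree_tsub_one]; omega
    refine degree_le_natDegree.trans_lt ?_
    have := hs.card_pos
    exact_mod_cast (by omega : M.natDegree < s.card)
  have hMi : ∀ i ∈ s, M.eval (v i) = N.eval (v i) / v i := fun i hi => by
    have hvi : v i ≠ 0 := fun h => hT0 (h ▸ hr i hi)
    have h := congrArg (eval (v i)) hNM
    simp only [eval_sub, eval_mul, eval_C, eval_X, hr i hi, mul_zero, sub_zero] at h
    rw [h, mul_div_cancel_left₀ _ hvi]
  have hMx : M.eval x = (Lagrange.nodal s v).eval x *
      ∑ i ∈ s, Lagrange.nodalWeight s v i * (x - v i)⁻¹ * M.eval (v i) := by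
    rw [← Lagrange.eval_interpolate_not_at_node _ hx, ← Lagrange.eq_interpolate hv hMd]
  have hn : (Lagrange.nodal s v).eval x ≠ 0 := by
    rw [Lagrange.eval_nodal, Finset.prod_ne_zero_iff]
    exact fun i hi => sub_ne_zero.2 (hx i hi)
  have hTx : T.eval x = T.leadingCoeff * (Lagrange.nodal s v).eval x := by
    conv_lhs => rw [eq_C_mul_nodal hv hTne hT hr]
    simp
  have hNx : N.eval x = A * T.eval x + x * M.eval x := by
    have h := congrArg (eval x) hNM
    simp only [eval_sub, eval_mul, eval_C, eval_X] at h
    rw [← h]; ring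
  have hTx0 : T.eval x ≠ 0 := by rw [hTx]; exact mul_ne_zero hl hn
  rw [hNx, add_div, mul_div_cancel_right₀ _ hTx0, hMx, hTx]
  congr 1
  rw [mul_left_comm, mul_comm T.leadingCoeff, mul_div_mul_left _ _ hn, mul_div_right_comm, Finset.mul_sum]
  refine Finset.sum_congr rfl fun i hi => ?_
  have hdT : T.derivative.eval (v i) =
      T.leadingCoeff * (Lagrange.nodal s v).derivative.eval (v i) := by
    conv_lhs => rw [eq_C_mul_nodal hv hTne hT hr]
    simp
  rw [hMi i hi, hdT, Lagrange.nodalWeight_eq_eval_derivative_nodal hi]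
  simp only [div_eq_mul_inv, mul_inv]
  ring

end PartialFractions

/-! ### Fibres of the exterior map as roots of a polynomial. -/

theorem ne_zero_of_ratDegree_pos {φ : RatFunc ℂ} (hd : 0 < ratDegree φ) : φ ≠ 0 := by
  rintro rfl
  simp [ratDegree] at hd

/-- The polynomial whose roots are the preimages of `z` under the rational function `R`. -/
def levelPoly (R : RatFunc ℂ) (z : ℂ) : ℂ[X] := R.num - C z * R.denom

theorem eval_levelPoly (R : RatFunc ℂ) (z w : ℂ) :
    (levelPoly R z).eval w = R.num.eval w - z * R.denom.eval w := by simp [levelPoly]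

theorem sphereMap_coe_eq_coe_iff_levelPoly {R : RatFunc ℂ} {w z : ℂ} :
    sphereMap R (w : OnePoint ℂ) = (z : OnePoint ℂ) ↔ (levelPoly R z).eval w = 0 := by
  rw [sphereMap_coe_eq_coe, eval_levelPoly, sub_eq_zero]
  refine ⟨fun ⟨h, e⟩ => (div_eq_iff h).1 e, fun e => ?_⟩
  have hq : R.denom.eval w ≠ 0 := fun h0 => by
    have := (isCoprime_iff_aeval_ne_zero_of_isAlgClosed ℂ ℂ _ _).1 R.isCoprime_num_denom w
    rw [h0, mul_zero] at e
    simp [e, h0] at this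
  exact ⟨hq, (div_eq_iff hq).2 e⟩

/-- Substituting `N w = z D w` in the quotient rule cancels one factor `D w`. -/
theorem deriv_finiteMap_eq {R : RatFunc ℂ} {w z : ℂ}
    (h : sphereMap R (w : OnePoint ℂ) = (z : OnePoint ℂ)) :
    deriv (finiteMap R) w = (levelPoly R z).derivative.eval w / R.denom.eval w := by
  obtain ⟨hq, e⟩ := sphereMap_coe_eq_coe.1 h
  have h1 := (R.num.hasDerivAt w).div (R.denom.hasDerivAt w) hq
  have h2 : deriv (finiteMap R) w = _ := h1.deriv
  rw [div_eq_iff hq] at e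
  rw [h2, e]
  simp only [levelPoly, derivative_sub, derivative_C_mul, eval_sub, eval_mul, eval_C]
  field_simp

/-- The lowest terms of the exterior map are a constant multiple of `exteriorNum`, `exteriorDenom`. -/
theorem exists_num_denom_exterior {φ : RatFunc ℂ} (h0 : φ ≠ 0) :
    ∃ c : ℂ, c ≠ 0 ∧ exteriorNum φ = C c * (exterior φ).num ∧
      exteriorDenom φ = C c * (exterior φ).denom := by
  refine exists_num_denom_eq ?_ (isCoprime_exterior φ h0)
  rw [exteriorDenom, Ne, reflect_eq_zero_iff, Polynomial.map_eq_zero]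
  simpa using h0

/-- The exterior map at the inverse `1 / conj u` of a nonzero point, in terms of the kernel. -/
theorem eval_num_div_eval_levelPoly_exterior {φ : RatFunc ℂ} (h0 : φ ≠ 0) {u : ℂ} (hu : u ≠ 0)
    (hq : φ.denom.eval u ≠ 0) (z : ℂ) :
    (exterior φ).num.eval (1 / conj u) / (levelPoly (exterior φ) z).eval (1 / conj u) =
      conj (1 - conj z * finiteMap φ u)⁻¹ := by
  obtain ⟨c, hc, hN, hD⟩ := exists_num_denom_exterior h0
  have hcu : conj u ≠ 0 := by simpa using hu
  have hw : 1 / conj u ≠ 0 := one_div_ne_zero hcu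
  have e : ∀ P : ℂ[X], P.natDegree ≤ ratDegree φ →
      ((P.map (starRingEnd ℂ)).reflect (ratDegree φ)).eval (1 / conj u) =
        (1 / conj u) ^ ratDegree φ * conj (P.eval u) := fun P hP => by
    rw [eval_reflect_map hP hw]; simp
  have e1 := e _ (le_max_right φ.num.natDegree φ.denom.natDegree)
  have e2 := e _ (le_max_left φ.num.natDegree φ.denom.natDegree)
  rw [← exteriorNum, hN, eval_mul, eval_C] at e1
  rw [← exteriorDenom, hD, eval_mul, eval_C] at e2
  have hq' : conj (φ.denom.eval u) ≠ 0 := by simpa using hq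
  rw [eval_levelPoly, ← mul_div_mul_left _ _ hc, mul_sub, mul_left_comm c z, e1, e2, finiteMap,
    map_inv₀, map_sub, map_one, map_mul, Complex.conj_conj, map_div₀, mul_left_comm z, ← mul_sub,
    mul_div_mul_left _ _ (pow_ne_zero _ hw)]
  have : conj (φ.denom.eval u) - z * conj (φ.num.eval u) =
    conj (φ.denom.eval u) * (1 - z * (conj (φ.num.eval u) / conj (φ.denom.eval u))) := by
      field_simp
  rw [this, div_mul_eq_div_div, div_self hq', one_div]

section Regular

variable {φ : RatFunc ℂ}

theorem coeff_exterior (h0 : φ ≠ 0) : ∃ c : ℂ, c ≠ 0 ∧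
    (∀ n, c * (exterior φ).num.coeff n = (exteriorNum φ).coeff n) ∧
    ∀ n, c * (exterior φ).denom.coeff n = (exteriorDenom φ).coeff n := by
  obtain ⟨c, hc, hN, hD⟩ := exists_num_denom_exterior h0
  exact ⟨c, hc, fun n => by rw [hN, coeff_C_mul], fun n => by rw [hD, coeff_C_mul]⟩

theorem natDegree_num_exterior_le (h0 : φ ≠ 0) :
    (exterior φ).num.natDegree ≤ ratDegree φ ∧ (exterior φ).denom.natDegree ≤ ratDegree φ := by
  obtain ⟨c, hc, hN, hD⟩ := exists_num_denom_exterior h0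
  rw [← natDegree_C_mul (p := (exterior φ).num) hc, ← natDegree_C_mul (p := (exterior φ).denom) hc,
    ← hN, ← hD]
  constructor <;> refine natDegree_reflect_le.trans ?_ <;> rw [natDegree_map] <;> simp [ratDegree]

/-- Up to a constant, the coefficients of `N` and `N - z D` in degree `ratDegree φ` are `conj (q 0)`
and `conj (q 0) - z * conj (p 0)`, where `φ = p / q`. Neither vanishes, because `|p 0| < |q 0|` and
`|z| < 1`. -/
theorem MapsDisc.ratDegree_exterior (hφ : MapsDisc φ) (h0 : φ ≠ 0) :
    ratDegree (exterior φ) = ratDegree φ ∧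
      ∀ z : 𝔻, (levelPoly (exterior φ) z).natDegree = ratDegree φ := by
  obtain ⟨c, hc, hN, hD⟩ := coeff_exterior h0
  obtain ⟨dN, dD⟩ := natDegree_num_exterior_le h0
  have hq : φ.denom.eval 0 ≠ 0 := hφ.denom_ne_zero (by simp)
  have cN := hN (ratDegree φ)
  have cD := hD (ratDegree φ)
  have rN : (exteriorNum φ).coeff (ratDegree φ) = conj (φ.denom.eval 0) := by
    simp [exteriorNum, coeff_reflect, ← coeff_zero_eq_eval_zero]
  have rD : (exteriorDenom φ).coeff (ratDegree φ) = conj (φ.num.eval 0) := by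
    simp [exteriorDenom, coeff_reflect, ← coeff_zero_eq_eval_zero]
  rw [rN] at cN
  rw [rD] at cD
  refine ⟨le_antisymm (max_le dN dD) (le_max_of_le_left (le_natDegree_of_ne_zero fun h => ?_)),
    fun z => le_antisymm ?_ (le_natDegree_of_ne_zero fun h => ?_)⟩
  · rw [h, mul_zero] at cN
    exact hq ((map_eq_zero _).1 cN.symm)
  · exact (natDegree_sub_le _ _).trans (max_le dN ((natDegree_C_mul_le _ _).trans dD))
  · rw [levelPoly, coeff_sub, coeff_C_mul, sub_eq_zero] at h
    rw [h, mul_left_comm, cD] at cN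
    have h1 := congrArg norm cN
    rw [norm_mul, RCLike.norm_conj, RCLike.norm_conj] at h1
    have h2 := hφ.norm_finiteMap_lt (w := 0) (by simp)
    rw [finiteMap, norm_div, div_lt_one (norm_pos_iff.2 hq)] at h2
    have h3 := z.norm_lt_one
    nlinarith [norm_nonneg (φ.num.eval 0), norm_nonneg (z : ℂ)]

theorem MapsDisc.encard_discPreimage (hφ : MapsDisc φ) (h0 : φ ≠ 0) {z : 𝔻}
    (hz : IsRegularValue (exterior φ) ((z : ℂ) : OnePoint ℂ)) :
    (discPreimage (exterior φ) ((z : ℂ) : OnePoint ℂ)).encard = ratDegree φ := by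
  rw [IsRegularValue, (hφ.ratDegree_exterior h0).1] at hz
  have hinj : Function.Injective fun w : 𝔻 => ((w : ℂ) : OnePoint ℂ) :=
    fun _ _ h => coe_unitDisc_injective h
  rw [← hz, ← hinj.encard_image]
  congr 1
  ext x
  constructor
  · rintro ⟨w, hw, rfl⟩
    exact hw
  · intro hx
    obtain ⟨w, rfl⟩ := hφ.exists_eq_coe_of_sphereMap_exterior h0 hx
    exact ⟨w, hx, rfl⟩

end Regular

/-! ### Expansion of the image of a kernel, and the adjoint. -/

namespace HardySpace

/-- The substitution `x = 1 / conj u` is unavailable at `u = 0`; continuity supplies the missing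
point. -/
theorem eq_zero_of_forall_ne {g : HardySpace} (h : ∀ u : 𝔻, u ≠ 0 → g u = 0) (u : 𝔻) :
    g u = 0 := by
  rcases ne_or_eq u 0 with hu | rfl
  · exact h u hu
  have hc : ContinuousAt (extendZero g) 0 :=
    (g.2.1.differentiableAt (Metric.ball_mem_nhds 0 one_pos)).continuousAt
  have h1 := hc.tendsto.mono_left (nhdsWithin_le_nhds (s := {0}ᶜ))
  have h2 : Filter.Tendsto (extendZero g) (nhdsWithin 0 {0}ᶜ) (nhds 0) := by
    refine tendsto_const_nhds.congr' ?_
    filter_upwards [self_mem_nhdsWithin,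
      nhdsWithin_le_nhds (Metric.ball_mem_nhds (0 : ℂ) one_pos)] with w hw hw1
    have hw1 : ‖w‖ < 1 := by simpa using hw1
    rw [extendZero_of_lt _ hw1, h]
    intro h0
    exact hw (by simpa using congrArg ((↑) : 𝔻 → ℂ) h0)
  have h3 := extendZero_coe g 0
  rw [Complex.UnitDisc.coe_zero] at h3
  rw [← h3]
  exact tendsto_nhds_unique h1 h2

theorem conj_smul_kernel_apply (a : ℂ) (w u : 𝔻) :
    (conj a • kernel w) u = conj (a * (1 - w * conj (u : ℂ))⁻¹) := by
  rw [smul_apply, kernel_apply]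
  simp

end HardySpace

open HardySpace

section Adjoint

variable {φ : RatFunc ℂ} {C : HardySpace →L[ℂ] HardySpace}

theorem IsCompositionOperator.kernel_apply (hC : IsCompositionOperator φ C) (hφ : MapsDisc φ)
    (z u : 𝔻) : C (kernel z) u = (1 - conj (z : ℂ) * finiteMap φ u)⁻¹ := by
  rw [hC _ _ _ (hφ.sphereMap_eq u), HardySpace.kernel_apply, hφ.coe_discMap]

theorem IsCompositionOperator.kernel_eq_sum (hC : IsCompositionOperator φ C) (hφ : MapsDisc φ)
    (hd : 0 < ratDegree φ) {z : 𝔻} {s : Finset 𝔻} (hs : s.card = ratDegree φ)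
    (hr : ∀ w ∈ s, (levelPoly (exterior φ) z).eval (w : ℂ) = 0)
    (h0 : (levelPoly (exterior φ) z).eval 0 ≠ 0) :
    C (kernel z) =
      conj ((exterior φ).num.eval 0 / (levelPoly (exterior φ) z).eval 0) • kernel 0 +
      ∑ w ∈ s, conj ((exterior φ).num.eval (w : ℂ) /
        ((w : ℂ) * (levelPoly (exterior φ) z).derivative.eval (w : ℂ))) • kernel w := by
  have hφ0 := ne_zero_of_ratDegree_pos hd
  rw [← sub_eq_zero]
  refine HardySpace.ext fun u => eq_zero_of_forall_ne (fun u hu => ?_) u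
  have hu0 : (u : ℂ) ≠ 0 := by simpa using hu
  have hcu : conj (u : ℂ) ≠ 0 := by simpa using hu0
  -- The evaluation point lies outside the disc and the nodes inside, so they never meet.
  have hx : ∀ w ∈ s, 1 / conj (u : ℂ) ≠ (w : ℂ) := fun w _ h => by
    have h1 := w.norm_lt_one
    rw [← h, norm_div, norm_one, RCLike.norm_conj, div_lt_one (norm_pos_iff.2 hu0)] at h1
    exact absurd u.norm_lt_one h1.not_gt
  have h := eval_div_eval_eq_sum (T := levelPoly (exterior φ) z) (s := s) (v := fun w : 𝔻 => (w : ℂ))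
    (N := (exterior φ).num) (x := 1 / conj (u : ℂ)) Complex.UnitDisc.coe_injective.injOn
    (Finset.card_pos.1 (hs ▸ hd)) (((hφ.ratDegree_exterior hφ0).2 z).trans hs.symm) hr h0
    (hs ▸ (natDegree_num_exterior_le hφ0).1) hx
  rw [eval_num_div_eval_levelPoly_exterior hφ0 hu0 (hφ.denom_ne_zero u.norm_lt_one)] at h
  have h2 := congrArg conj h
  rw [Complex.conj_conj, ← hC.kernel_apply hφ] at h2
  rw [HardySpace.sub_apply, h2, add_apply, sum_apply, conj_smul_kernel_apply, map_add, map_sum]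
  rw [sub_eq_zero]
  congr 1
  · simp
  · refine Finset.sum_congr rfl fun w _ => ?_
    rw [conj_smul_kernel_apply]
    congr 2
    -- Multiplying through by `conj u` turns `x / (x - w)` into `1 / (1 - w * conj u)`.
    rw [← mul_div_mul_left _ _ hcu, mul_sub, mul_one_div_cancel hcu, one_div, mul_comm (w : ℂ)]

theorem adjoint_apply_eq_inner (C : HardySpace →L[ℂ] HardySpace) (f : HardySpace) (z : 𝔻) :
    (ContinuousLinearMap.adjoint C f) z = inner ℂ (C (kernel z)) f := by
  rw [← inner_kernel, ContinuousLinearMap.adjoint_inner_right]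

theorem IsCompositionOperator.adjoint_apply (hC : IsCompositionOperator φ C) (hφ : MapsDisc φ)
    (hd : 0 < ratDegree φ) (f : HardySpace) {z : 𝔻} {s : Finset 𝔻} (hs : s.card = ratDegree φ)
    (hr : ∀ w ∈ s, (levelPoly (exterior φ) z).eval (w : ℂ) = 0)
    (h0 : (levelPoly (exterior φ) z).eval 0 ≠ 0) :
    (ContinuousLinearMap.adjoint C f) z =
      (exterior φ).num.eval 0 / (levelPoly (exterior φ) z).eval 0 * f 0 +
      (z : ℂ) * ∑ w ∈ s, f w / ((w : ℂ) * deriv (finiteMap (exterior φ)) w) := by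
  rw [adjoint_apply_eq_inner, hC.kernel_eq_sum hφ hd hs hr h0, inner_add_left, sum_inner,
    inner_smul_left, inner_kernel, Complex.conj_conj, Finset.mul_sum]
  congr 1
  refine Finset.sum_congr rfl fun w hw => ?_
  have h := sphereMap_coe_eq_coe_iff_levelPoly.2 (hr w hw)
  obtain ⟨hq, e⟩ := sphereMap_coe_eq_coe.1 h
  -- The relation `N w = z D w` produces the factor `z` in front of the sum.
  rw [div_eq_iff hq] at e
  rw [inner_smul_left, inner_kernel, Complex.conj_conj, deriv_finiteMap_eq h, e]
  field_simp

/-- The origin is a root exactly when `φ_e 0 = z`, and `φ_e 0` is the inverse point of `φ ∞`. -/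
theorem eval_zero_levelPoly_exterior_ne_zero (h0 : φ ≠ 0) {z : ℂ}
    (hz : (z : OnePoint ℂ) ≠ inversion (sphereMap φ ∞)) :
    (levelPoly (exterior φ) z).eval 0 ≠ 0 := fun h => by
  refine hz ?_
  rw [← sphereMap_coe_eq_coe_iff_levelPoly.2 h, sphereMap_exterior φ h0]
  simp [inversion]

/-- Reversing polynomials moves their top coefficients to the constant terms, so the behaviour of
`φ` at infinity determines this quotient. -/
theorem eval_zero_num_div_levelPoly_exterior (h0 : φ ≠ 0) (z : ℂ) :
    (exterior φ).num.eval 0 / (levelPoly (exterior φ) z).eval 0 =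
      conj (φ.denom.coeff (ratDegree φ)) /
        (conj (φ.denom.coeff (ratDegree φ)) - z * conj (φ.num.coeff (ratDegree φ))) := by
  obtain ⟨c, hc, hN, hD⟩ := exists_num_denom_exterior h0
  obtain ⟨e1, e2⟩ := coeff_zero_exterior φ
  rw [← e1, ← e2, hN, hD, eval_levelPoly, eval_mul, eval_mul, eval_C, mul_left_comm z, ← mul_sub,
    mul_div_mul_left _ _ hc]

theorem eval_zero_num_div_levelPoly_exterior_of_finite (h0 : φ ≠ 0) (z : ℂ) {c : ℂ}
    (hc : sphereMap φ ∞ = (c : OnePoint ℂ)) :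
    (exterior φ).num.eval 0 / (levelPoly (exterior φ) z).eval 0 = 1 / (1 - conj c * z) := by
  have hlt : ¬ φ.denom.natDegree < φ.num.natDegree := fun h => by
    simp [sphereMap, h] at hc
  have hcc : φ.num.coeff φ.denom.natDegree = c := by
    simpa [sphereMap, hlt] using hc
  have e : ratDegree φ = φ.denom.natDegree := max_eq_right (not_lt.1 hlt)
  rw [eval_zero_num_div_levelPoly_exterior h0, e, hcc, (RatFunc.monic_denom φ).coeff_natDegree,
    map_one, mul_comm z]

theorem eval_zero_num_div_levelPoly_exterior_of_infty (h0 : φ ≠ 0) (z : ℂ)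
    (hc : sphereMap φ ∞ = ∞) :
    (exterior φ).num.eval 0 / (levelPoly (exterior φ) z).eval 0 = 0 := by
  have hlt : φ.denom.natDegree < φ.num.natDegree := by
    by_contra h
    simp [sphereMap, h] at hc
  have e : ratDegree φ = φ.num.natDegree := max_eq_left hlt.le
  rw [eval_zero_num_div_levelPoly_exterior h0, e, coeff_eq_zero_of_natDegree_lt hlt, map_zero,
    zero_div]

/-- The kernel at the origin is the constant `1`, which composition fixes. -/
theorem IsCompositionOperator.adjoint_apply_zero (hC : IsCompositionOperator φ C)
    (hφ : MapsDisc φ) (f : HardySpace) : (ContinuousLinearMap.adjoint C f) 0 = f 0 := by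
  rw [adjoint_apply_eq_inner, ← inner_kernel 0 f]
  congr 1
  ext u
  rw [hC.kernel_apply hφ, HardySpace.kernel_apply]
  simp

end Adjoint

end HardyComposition

end

/-! ### The adjoint formula. -/

open HardyComposition in
theorem corollary2p2 (φ : RatFunc ℂ) (hφ : MapsDisc φ) (hd : 0 < ratDegree φ) :
    (∃! C : HardySpace →L[ℂ] HardySpace, IsCompositionOperator φ C) ∧
    ∀ C : HardySpace →L[ℂ] HardySpace, IsCompositionOperator φ C →
    ∀ (f : HardySpace) (z : 𝔻), IsRegularValue (exterior φ) ((z : ℂ) : OnePoint ℂ) →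
      -- the whole preimage of `z` lies in the disc, and no denominator below vanishes
      (∀ x : OnePoint ℂ, sphereMap (exterior φ) x = ((z : ℂ) : OnePoint ℂ) →
        ∃ w : 𝔻, x = ((w : ℂ) : OnePoint ℂ) ∧ deriv (finiteMap (exterior φ)) w ≠ 0 ∧
          (((z : ℂ) : OnePoint ℂ) ≠ inversion (sphereMap φ ∞) → w ≠ 0)) ∧
      -- the case of a finite value at infinity
      (∀ c : ℂ, sphereMap φ ∞ = (c : OnePoint ℂ) →
        ((z : ℂ) : OnePoint ℂ) ≠ inversion (c : OnePoint ℂ) →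
        (ContinuousLinearMap.adjoint C f) z = f 0 / (1 - conj c * (z : ℂ)) +
          (z : ℂ) * ∑ᶠ w ∈ discPreimage (exterior φ) ((z : ℂ) : OnePoint ℂ),
            f w / ((w : ℂ) * deriv (finiteMap (exterior φ)) w)) ∧
      -- the case of a pole at infinity
      (sphereMap φ ∞ = ∞ →
        (z ≠ 0 → (ContinuousLinearMap.adjoint C f) z =
          (z : ℂ) * ∑ᶠ w ∈ discPreimage (exterior φ) ((z : ℂ) : OnePoint ℂ),
            f w / ((w : ℂ) * deriv (finiteMap (exterior φ)) w)) ∧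
        (z = 0 → (ContinuousLinearMap.adjoint C f) z = f 0)) := by
  have h0 := ne_zero_of_ratDegree_pos hd
  refine ⟨hφ.existsUnique_isCompositionOperator, fun C hC f z hz => ?_⟩
  have hcard := hφ.encard_discPreimage h0 hz
  have hfin : (discPreimage (exterior φ) ((z : ℂ) : OnePoint ℂ)).Finite :=
    Set.finite_of_encard_eq_coe hcard
  set s := hfin.toFinset with hs_def
  have hs : s.card = ratDegree φ := by
    rw [hfin.encard_eq_coe_toFinset_card] at hcard
    exact_mod_cast hcard
  have hr : ∀ w ∈ s, (levelPoly (exterior φ) z).eval (w : ℂ) = 0 := fun w hw =>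
    sphereMap_coe_eq_coe_iff_levelPoly.1 (hfin.mem_toFinset.1 hw)
  have hT := (hφ.ratDegree_exterior h0).2 z
  have hT0 : levelPoly (exterior φ) z ≠ 0 := by
    intro h
    rw [h, natDegree_zero] at hT
    omega
  simp only [finsum_mem_eq_finite_toFinset_sum _ hfin, ← hs_def]
  refine ⟨fun x hx => ?_, fun c hc hzc => ?_, fun hc => ⟨fun hz0 => ?_, ?_⟩⟩
  · obtain ⟨w, rfl⟩ := hφ.exists_eq_coe_of_sphereMap_exterior h0 hx
    refine ⟨w, rfl, ?_, ?_⟩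
    · rw [deriv_finiteMap_eq hx]
      exact div_ne_zero (eval_derivative_ne_zero (v := fun w : 𝔻 => (w : ℂ))
        Complex.UnitDisc.coe_injective.injOn hT0 (hT.trans hs.symm) hr
        (hfin.mem_toFinset.2 hx)) (sphereMap_coe_eq_coe.1 hx).1
    · rintro hzi rfl
      exact eval_zero_levelPoly_exterior_ne_zero h0 hzi
        (by simpa using sphereMap_coe_eq_coe_iff_levelPoly.1 hx)
  · have hz1 := eval_zero_levelPoly_exterior_ne_zero h0 (z := z) (by rwa [hc])
    rw [hC.adjoint_apply hφ hd f hs hr hz1,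
      eval_zero_num_div_levelPoly_exterior_of_finite h0 _ hc, one_div_mul_eq_div]
  · have hz1 := eval_zero_levelPoly_exterior_ne_zero h0 (z := z) (by
      rw [hc]
      simpa [inversion] using hz0)
    rw [hC.adjoint_apply hφ hd f hs hr hz1,
      eval_zero_num_div_levelPoly_exterior_of_infty h0 _ hc, zero_mul, zero_add]
  · rintro rfl
    exact hC.adjoint_apply_zero hφ f
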